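/- Let $\Omega$ be a set of two-input Boolean gates containing AND and OR. Boolean circuits on variables $x_1,\dots,x_n$ are built from gates in $\Omega$ with unrestricted fan-out; the inputs of a gate, and the output of the circuit, are variables or (earlier) gates. Assume that either the negated variables $\neg x_i$ are also available as inputs without being counted as gates, or $\Omega$ contains a gate $\omega$ with $\omega(a,a)=\neg a$ for $a\in\{0,1\}$ (e.g. $\Omega$ is the set of all two-input gates). For real $g$ let $\psi(n,g)$ be the number of Boolean functions of $n$ variables that can be computed by such a circuit with at most $g$ gates. Let $\gamma$ be a function from the positive integers to the non-negative integers such that $\gamma(n)\le 2^{n-2}/n$ for all sufficiently large $n$, and such that $\gamma(n)$ outstrips $n\log_2 n$, i.e. for every constant $c>0$ there is $n_0$ such that $\gamma(n)>c\,n\log_2 n$ for all $n\ge n_0$. Then for every fixed real $d$, $$\psi(n,\gamma(n))\ \ge\ n^d\,\psi(n,\gamma(n)/2)$$ for all sufficiently large $n$. -/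

import Mathlib

open Filter

/-- What circuits may be built from: a set of two-input gate types, and whether the negated
variables are available as inputs free of charge, besides the variables. -/
structure GateBasis where
  gates : Set (Bool → Bool → Bool)
  negatedInputs : Prop

/-- A point that a gate (or the output) of a circuit may read, when `n` variables and `m`
previously built gates are available. -/
inductive Wire (B : GateBasis) (n m : ℕ) : Type
  | input (i : Fin n) : Wire B n m
  | negInput (h : B.negatedInputs) (i : Fin n) : Wire B n m
  | gate (j : Fin m) : Wire B n m

/-- The bit carried by a wire, given the input `x` and the values `v` of the earlier gates. -/
def Wire.eval {B : GateBasis} {n m : ℕ} (x : Fin n → Bool) (v : Fin m → Bool) :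
    Wire B n m → Bool
  | .input i => x i
  | .negInput _ i => !x i
  | .gate j => v j

/-- A two-input gate that reads inputs or the first `m` gates. -/
structure Gate (B : GateBasis) (n m : ℕ) where
  op : Bool → Bool → Bool
  op_mem : op ∈ B.gates
  left : Wire B n m
  right : Wire B n m

def Gate.eval {B : GateBasis} {n m : ℕ} (G : Gate B n m) (x : Fin n → Bool)
    (v : Fin m → Bool) : Bool :=
  G.op (G.left.eval x v) (G.right.eval x v)

/-- A topologically ordered list of `s` gates; fan-out is unrestricted, since a gate may be
read by any number of later gates. -/
inductive GateList (B : GateBasis) (n : ℕ) : ℕ → Type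
  | nil : GateList B n 0
  | snoc {s : ℕ} (L : GateList B n s) (G : Gate B n s) : GateList B n (s + 1)

/-- The values of all gates on input `x`. -/
def GateList.values {B : GateBasis} {n : ℕ} (x : Fin n → Bool) :
    {s : ℕ} → GateList B n s → Fin s → Bool
  | _, .nil => Fin.elim0
  | _, .snoc L G => Fin.snoc (α := fun _ => Bool) (L.values x) (G.eval x (L.values x))

/-- A Boolean circuit over the basis `B` with `n` input variables and exactly `s` gates. -/
structure BoolCircuit (B : GateBasis) (n s : ℕ) where
  gates : GateList B n s
  output : Wire B n s

/-- The Boolean function of `n` variables computed by a circuit. -/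
def BoolCircuit.eval {B : GateBasis} {n s : ℕ} (C : BoolCircuit B n s) (x : Fin n → Bool) :
    Bool :=
  C.output.eval x (C.gates.values x)

/-- `psi B n g` is the number of Boolean functions of `n` variables that are computable by
circuits over `B` with at most `g` gates, where the bound `g` may be any real number. -/
noncomputable def psi (B : GateBasis) (n : ℕ) (g : ℝ) : ℕ :=
  Set.ncard {f : (Fin n → Bool) → Bool |
    ∃ s : ℕ, (s : ℝ) ≤ g ∧ ∃ C : BoolCircuit B n s, C.eval = f}

/-- `γ` outstrips `l`: eventually `γ` exceeds any constant times `l`. -/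
def Outstrips (γ l : ℕ → ℝ) : Prop :=
  ∀ c : ℝ, 0 < c → ∃ n₀ : ℕ, ∀ n : ℕ, n₀ ≤ n → c * l n < γ n

/-! ### Edge isoperimetry in the Boolean cube. -/

section EdgeIsoperimetry

variable {ι : Type*} [DecidableEq ι]

/-! View Boolean functions of `n` variables as vertices of a cube of dimension `2 ^ n`, and let `F`
be those computable with `g` gates. Edge isoperimetry (`sum_card_filter_flipAt_le`) shows that,
while `log₂ |F| ≤ 3/4 * 2 ^ n`, some input `a` has the property that changing the value at `a` keeps
at most 3/4 of `F` inside `F`. Such a change costs at most `2 * n + 2` gates (`Computes.flipAt`), so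
that many extra gates multiply the count by at least 5/4. Iterating `O(log n)` times gains the
factor `n ^ d` for `O(n log n)` gates, which fits into `γ n / 2`. Counting circuits
(`psi_le_two_rpow`) keeps the families small enough throughout. -/

/-- The neighbour of `f` in the Boolean cube in direction `i`. -/
def flipAt (i : ι) (f : ι → Bool) : ι → Bool := Function.update f i (!f i)

@[simp] lemma flipAt_same (i : ι) (f : ι → Bool) : flipAt i f i = !f i := by
  simp [flipAt]

lemma flipAt_of_ne {i j : ι} (h : j ≠ i) (f : ι → Bool) : flipAt i f j = f j := by
  simp [flipAt, h]

lemma flipAt_involutive (i : ι) : Function.Involutive (flipAt i) := by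
  intro f
  simp [flipAt]

lemma flipAt_ne (i : ι) (f : ι → Bool) : flipAt i f ≠ f := by
  intro h
  simpa using congrFun h i

/-- For `a ≤ b` this is Bernoulli's inequality `2 ^ p ≤ 1 + p` at `p = a / b ≤ 1`; for `b ≤ a` the
logarithm is at least 1. -/
lemma le_mul_logb_one_add_div {a b : ℝ} (ha : 0 < a) (hb : 0 < b) :
    min a b ≤ b * Real.logb 2 ((a + b) / b) := by
  rcases le_total a b with hab | hab
  · rw [min_eq_left hab]
    have h1 : (2 : ℝ) ^ (a / b) ≤ (a + b) / b := by
      have := rpow_one_add_le_one_add_mul_self (s := 1) (p := a / b) (by norm_num)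
        (by positivity) ((div_le_one hb).2 hab)
      norm_num at this
      refine this.trans (le_of_eq ?_)
      field_simp
      ring
    have h2 : a / b ≤ Real.logb 2 ((a + b) / b) := by
      rw [Real.le_logb_iff_rpow_le (by norm_num) (by positivity)]
      exact h1
    calc a = b * (a / b) := by field_simp
      _ ≤ _ := by gcongr
  · rw [min_eq_right hab]
    have h2 : 1 ≤ Real.logb 2 ((a + b) / b) := by
      rw [Real.le_logb_iff_rpow_le (by norm_num) (by positivity), Real.rpow_one,
        le_div_iff₀ hb]
      linarith
    nlinarith

lemma mul_logb_add_mul_logb_le {a b : ℝ} (ha : 0 < a) (hb : 0 < b) :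
    a * Real.logb 2 a + b * Real.logb 2 b + 2 * min a b ≤ (a + b) * Real.logb 2 (a + b) := by
  have h1 := le_mul_logb_one_add_div ha hb
  have h2 := le_mul_logb_one_add_div hb ha
  rw [Real.logb_div (by positivity) (by positivity)] at h1 h2
  rw [min_comm, add_comm b a] at h2
  linarith

variable [Fintype ι]

lemma card_filter_flipAt_same_le (F : Finset (ι → Bool)) (i : ι) (b : Bool) :
    (F.filter fun f : ι → Bool => f i = b ∧ flipAt i f ∈ F).card ≤
      min (F.filter fun f : ι → Bool => f i = false).card (F.filter fun f : ι → Bool => f i = true).card := by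
  have h1 : (F.filter fun f : ι → Bool => f i = b ∧ flipAt i f ∈ F).card ≤
      (F.filter fun f : ι → Bool => f i = b).card :=
    Finset.card_le_card fun f hf => by
      simp only [Finset.mem_filter] at hf ⊢
      exact ⟨hf.1, hf.2.1⟩
  have h2 : (F.filter fun f : ι → Bool => f i = b ∧ flipAt i f ∈ F).card ≤
      (F.filter fun f : ι → Bool => f i = !b).card :=
    Finset.card_le_card_of_injOn (flipAt i)
      (fun f hf => by
        simp only [Finset.coe_filter, Set.mem_ofPred_eq] at hf ⊢
        exact ⟨hf.2.2, by simp [hf.2.1]⟩)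
      (flipAt_involutive i).injective.injOn
  cases b
  · exact le_min h1 h2
  · exact le_min h2 h1

/-- Split `F` by coordinate `i`: edges in other directions stay within a half, while those in
direction `i` match points of the two halves and are counted from both ends. -/
lemma card_filter_flipAt_le (F : Finset (ι → Bool)) (i j : ι) :
    (F.filter fun f : ι → Bool => flipAt j f ∈ F).card ≤
      ((F.filter fun f : ι → Bool => f i = false).filter
        fun f : ι → Bool => flipAt j f ∈ F.filter fun f : ι → Bool => f i = false).card +
      ((F.filter fun f : ι → Bool => f i = true).filter
        fun f : ι → Bool => flipAt j f ∈ F.filter fun f : ι → Bool => f i = true).card +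
      (if j = i then 2 * min (F.filter fun f : ι → Bool => f i = false).card
        (F.filter fun f : ι → Bool => f i = true).card else 0) := by
  split_ifs with h
  · subst h
    have hu : (F.filter fun f : ι → Bool => flipAt j f ∈ F) ⊆
        (F.filter fun f : ι → Bool => f j = false ∧ flipAt j f ∈ F) ∪
        (F.filter fun f : ι → Bool => f j = true ∧ flipAt j f ∈ F) := by
      intro f hf
      simp only [Finset.mem_filter, Finset.mem_union] at hf ⊢
      cases f j <;> simp [hf]
    have h0 := (Finset.card_le_card hu).trans (Finset.card_union_le _ _)
    have h1 := card_filter_flipAt_same_le F j false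
    have h2 := card_filter_flipAt_same_le F j true
    omega
  · rw [add_zero]
    refine (Finset.card_le_card ?_).trans (Finset.card_union_le _ _)
    intro f hf
    simp only [Finset.mem_filter, Finset.mem_union, flipAt_of_ne (Ne.symm h)] at hf ⊢
    cases f i <;> simp [hf]

/-- The edge-isoperimetric inequality in the Boolean cube. -/
theorem sum_card_filter_flipAt_le (F : Finset (ι → Bool)) :
    ∑ i, ((F.filter fun f : ι → Bool => flipAt i f ∈ F).card : ℝ) ≤ F.card * Real.logb 2 F.card := by
  induction hn : F.card using Nat.strong_induction_on generalizing F with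
  | _ n ih =>
  subst hn
  by_cases hF : F.card ≤ 1
  · have h0 : ∀ i, (F.filter fun f : ι → Bool => flipAt i f ∈ F) = ∅ := by
      intro i
      refine Finset.filter_eq_empty_iff.2 fun f hf hf' => flipAt_ne i f ?_
      exact Finset.card_le_one.1 hF _ hf' _ hf
    have : F.card = 0 ∨ F.card = 1 := by omega
    rcases this with h | h <;> simp [h0, h]
  -- Splitting at a coordinate where two members differ makes both halves nonempty, hence both
  -- smaller than `F`.
  obtain ⟨f, hf, g, hg, hfg⟩ := Finset.one_lt_card.1 (not_le.1 hF)
  obtain ⟨i, hi⟩ := Function.ne_iff.1 hfg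
  set F0 := F.filter fun f : ι → Bool => f i = false with hF0
  set F1 := F.filter fun f : ι → Bool => f i = true with hF1
  have hsum : F0.card + F1.card = F.card := by
    have := Finset.card_filter_add_card_filter_not (s := F) (fun f => f i = false)
    simpa [hF0, hF1] using this
  have hpos : 0 < F0.card ∧ 0 < F1.card := by
    simp only [Finset.card_pos]
    cases hfi : f i <;> cases hgi : g i
    · simp [hfi, hgi] at hi
    · exact ⟨⟨f, by simp [hF0, hf, hfi]⟩, ⟨g, by simp [hF1, hg, hgi]⟩⟩
    · exact ⟨⟨g, by simp [hF0, hg, hgi]⟩, ⟨f, by simp [hF1, hf, hfi]⟩⟩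
    · simp [hfi, hgi] at hi
  have ih0 := ih F0.card (by omega) F0 rfl
  have ih1 := ih F1.card (by omega) F1 rfl
  have hle : ∑ j, ((F.filter fun f : ι → Bool => flipAt j f ∈ F).card : ℝ) ≤
      ∑ j, (((F0.filter fun f : ι → Bool => flipAt j f ∈ F0).card : ℝ) +
        ((F1.filter fun f : ι → Bool => flipAt j f ∈ F1).card : ℝ) +
        (if j = i then 2 * min (F0.card : ℝ) (F1.card : ℝ) else 0)) := by
    refine Finset.sum_le_sum fun j _ => ?_
    exact_mod_cast card_filter_flipAt_le F i j
  rw [Finset.sum_add_distrib, Finset.sum_add_distrib, Finset.sum_ite_eq' Finset.univ i,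
    if_pos (Finset.mem_univ i)] at hle
  have hlog := mul_logb_add_mul_logb_le (a := F0.card) (b := F1.card)
    (by exact_mod_cast hpos.1) (by exact_mod_cast hpos.2)
  rw [← hsum]
  push_cast
  linarith

/-- A family that is not too large expands in some direction. -/
theorem exists_card_le_card_union_image_flipAt [Nonempty ι]
    (F : Finset (ι → Bool)) (hF : Real.logb 2 F.card ≤ 3 / 4 * Fintype.card ι) :
    ∃ i, 5 / 4 * (F.card : ℝ) ≤ (F ∪ F.image (flipAt i)).card := by
  obtain ⟨i, -, hi⟩ : ∃ i ∈ (Finset.univ : Finset ι),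
      ((F.filter fun f : ι → Bool => flipAt i f ∈ F).card : ℝ) ≤ 3 / 4 * F.card := by
    refine Finset.exists_le_of_sum_le Finset.univ_nonempty ?_
    refine (sum_card_filter_flipAt_le F).trans ?_
    rw [Finset.sum_const, nsmul_eq_mul, Finset.card_univ]
    calc (F.card : ℝ) * Real.logb 2 F.card ≤ F.card * (3 / 4 * Fintype.card ι) := by gcongr
      _ = _ := by ring
  refine ⟨i, ?_⟩
  have hinter : F ∩ F.image (flipAt i) = F.filter fun f : ι → Bool => flipAt i f ∈ F := by
    ext f
    simp only [Finset.mem_inter, Finset.mem_image, Finset.mem_filter, and_congr_right_iff]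
    intro _
    constructor
    · rintro ⟨g, hg, rfl⟩
      rwa [flipAt_involutive]
    · exact fun h => ⟨_, h, flipAt_involutive i f⟩
  have hcard := Finset.card_union_add_card_inter F (F.image (flipAt i))
  rw [hinter, Finset.card_image_of_injective _ (flipAt_involutive i).injective] at hcard
  have : ((F ∪ F.image (flipAt i)).card : ℝ) + (F.filter fun f : ι → Bool => flipAt i f ∈ F).card =
      F.card + F.card := by exact_mod_cast hcard
  linarith

end EdgeIsoperimetry

/-! ### Changing one value of a function by a few gates. -/

section Circuits

variable {B : GateBasis} {n : ℕ}

/-- Some list of `s` gates computes all functions in `H` simultaneously. -/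
def Computes (B : GateBasis) (n s : ℕ) (H : Set ((Fin n → Bool) → Bool)) : Prop :=
  ∃ L : GateList B n s, ∀ h ∈ H, ∃ w : Wire B n s, ∀ x, w.eval x (L.values x) = h x

/-- A wire stays available when a gate is added. -/
def Wire.lift {m : ℕ} : Wire B n m → Wire B n (m + 1)
  | .input i => .input i
  | .negInput h i => .negInput h i
  | .gate j => .gate j.castSucc

lemma Wire.eval_lift {m : ℕ} (w : Wire B n m) (x : Fin n → Bool) (v : Fin m → Bool)
    (b : Bool) : w.lift.eval x (Fin.snoc (α := fun _ => Bool) v b) = w.eval x v := by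
  cases w <;> simp [Wire.lift, Wire.eval]

namespace Computes

variable {s : ℕ} {H : Set ((Fin n → Bool) → Bool)}

lemma mono {K : Set ((Fin n → Bool) → Bool)} (hH : Computes B n s H) (hK : K ⊆ H) :
    Computes B n s K := by
  obtain ⟨L, hL⟩ := hH
  exact ⟨L, fun h hh => hL h (hK hh)⟩

lemma insert_input (hH : Computes B n s H) (i : Fin n) :
    Computes B n s (insert (fun x => x i) H) := by
  obtain ⟨L, hL⟩ := hH
  refine ⟨L, ?_⟩
  rintro h (rfl | hh)
  · exact ⟨.input i, fun x => rfl⟩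
  · exact hL h hh

lemma insert_negInput (hH : Computes B n s H) (hB : B.negatedInputs) (i : Fin n) :
    Computes B n s (insert (fun x => !x i) H) := by
  obtain ⟨L, hL⟩ := hH
  refine ⟨L, ?_⟩
  rintro h (rfl | hh)
  · exact ⟨.negInput hB i, fun x => rfl⟩
  · exact hL h hh

lemma insert_op (hH : Computes B n s H) {op : Bool → Bool → Bool} (hop : op ∈ B.gates)
    {h₁ h₂ : (Fin n → Bool) → Bool} (hh₁ : h₁ ∈ H) (hh₂ : h₂ ∈ H) :
    Computes B n (s + 1) (insert (fun x => op (h₁ x) (h₂ x)) H) := by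
  obtain ⟨L, hL⟩ := hH
  obtain ⟨w₁, hw₁⟩ := hL _ hh₁
  obtain ⟨w₂, hw₂⟩ := hL _ hh₂
  refine ⟨L.snoc ⟨op, hop, w₁, w₂⟩, ?_⟩
  rintro h (rfl | hh)
  · exact ⟨.gate (Fin.last s), fun x => by
      simp only [← hw₁, ← hw₂]
      rw [Wire.eval, GateList.values, Fin.snoc_last, Gate.eval]⟩
  · obtain ⟨w, hw⟩ := hL h hh
    exact ⟨w.lift, fun x => by rw [GateList.values, Wire.eval_lift, hw]⟩

lemma insert_literal (hneg : B.negatedInputs ∨ ∃ op ∈ B.gates, ∀ a : Bool, op a a = !a)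
    (hH : Computes B n s H) (i : Fin n) (b : Bool) :
    ∃ s' ≤ s + 1, Computes B n s' (insert (fun x => x i ^^ b) H) := by
  cases b
  · simpa using ⟨s, Nat.le_succ s, hH.insert_input i⟩
  · simp only [Bool.xor_true]
    rcases hneg with hB | ⟨op, hop, hop'⟩
    · exact ⟨s, Nat.le_succ s, hH.insert_negInput hB i⟩
    · refine ⟨s + 1, le_rfl, ?_⟩
      have := (hH.insert_input i).insert_op hop (Set.mem_insert _ _) (Set.mem_insert _ _)
      simp only [hop'] at this
      exact this.mono (Set.insert_subset_insert (Set.subset_insert _ _))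

/-- Each literal costs at most two gates: one for a possible negation, one for `op`. -/
lemma insert_foldl_literal
    (hneg : B.negatedInputs ∨ ∃ op ∈ B.gates, ∀ a : Bool, op a a = !a)
    {op : Bool → Bool → Bool} (hop : op ∈ B.gates) (b : Fin n → Bool) (l : List (Fin n)) :
    ∀ {s : ℕ} {H : Set ((Fin n → Bool) → Bool)}, Computes B n s H → ∀ h ∈ H,
      ∃ s' ≤ s + 2 * l.length, Computes B n s'
        (insert (fun x => l.foldl (fun c i => op c (x i ^^ b i)) (h x)) H) := by
  induction l with
  | nil =>
    intro s H hH h hh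
    refine ⟨s, by simp, ?_⟩
    simpa [Set.insert_eq_of_mem hh] using hH
  | cons i l ih =>
    intro s H hH h hh
    obtain ⟨s₁, hs₁, h₁⟩ := hH.insert_literal hneg i (b i)
    have h₂ := h₁.insert_op hop (Set.mem_insert_of_mem _ hh) (Set.mem_insert _ _)
    obtain ⟨s₂, hs₂, h₃⟩ := ih h₂ _ (Set.mem_insert _ _)
    refine ⟨s₂, by simp only [List.length_cons]; omega, h₃.mono ?_⟩
    exact Set.insert_subset_insert
      ((Set.subset_insert _ _).trans (Set.subset_insert _ _))

end Computes

lemma foldl_and_eq_true {α : Type*} (p : α → Bool) (l : List α) (c : Bool) :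
    l.foldl (fun c i => c && p i) c = true ↔ c = true ∧ ∀ i ∈ l, p i = true := by
  induction l generalizing c with
  | nil => simp
  | cons i l ih => simp [ih, and_assoc]

lemma foldl_or_eq_true {α : Type*} (p : α → Bool) (l : List α) (c : Bool) :
    l.foldl (fun c i => c || p i) c = true ↔ c = true ∨ ∃ i ∈ l, p i = true := by
  induction l generalizing c with
  | nil => simp
  | cons i l ih => simp [ih, or_assoc]

/-- Changing one value of a function costs at most `2 * n + 2` gates. -/
theorem Computes.flipAt (hand : (fun a b : Bool => a && b) ∈ B.gates)
    (hor : (fun a b : Bool => a || b) ∈ B.gates)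
    (hneg : B.negatedInputs ∨ ∃ op ∈ B.gates, ∀ a : Bool, op a a = !a)
    (hn : 0 < n) {s : ℕ} {f : (Fin n → Bool) → Bool} (hf : Computes B n s {f})
    (a : Fin n → Bool) :
    ∃ s' ≤ s + (2 * n + 2), Computes B n s' {flipAt a f} := by
  have hlen : (List.finRange n).length = n := List.length_finRange
  cases hfa : f a
  -- OR `f` with the minterm of `a`. No constant is available, so the fold is seeded with the first
  -- literal, whose repetition is harmless. Cost: 1 for the seed, `2 * n` for the fold, 1 for the
  -- last gate.
  · obtain ⟨s₁, hs₁, h₁⟩ := hf.insert_literal hneg ⟨0, hn⟩ (!a ⟨0, hn⟩)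
    obtain ⟨s₂, hs₂, h₂⟩ := h₁.insert_foldl_literal hneg hand (fun i => !a i)
      (List.finRange n) _ (Set.mem_insert _ _)
    have h₃ := h₂.insert_op hor (h₁ := f) (by simp) (Set.mem_insert _ _)
    refine ⟨s₂ + 1, by omega, h₃.mono ?_⟩
    rw [Set.singleton_subset_iff]
    left
    funext x
    rw [Bool.eq_iff_iff, Bool.or_eq_true, foldl_and_eq_true]
    by_cases hx : x = a
    · subst hx
      simp [hfa]
    · rw [flipAt_of_ne hx]
      obtain ⟨i, hi⟩ := Function.ne_iff.1 hx
      have : ¬ ∀ i ∈ List.finRange n, (x i ^^ !a i) = true := fun h => hi (by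
        simpa using h i (List.mem_finRange i))
      simp only [this, and_false, or_false]
  -- Dually, AND `f` with the clause that is false only at `a`.
  · obtain ⟨s₁, hs₁, h₁⟩ := hf.insert_literal hneg ⟨0, hn⟩ (a ⟨0, hn⟩)
    obtain ⟨s₂, hs₂, h₂⟩ := h₁.insert_foldl_literal hneg hor a
      (List.finRange n) _ (Set.mem_insert _ _)
    have h₃ := h₂.insert_op hand (h₁ := f) (by simp) (Set.mem_insert _ _)
    refine ⟨s₂ + 1, by omega, h₃.mono ?_⟩
    rw [Set.singleton_subset_iff]
    left
    funext x
    rw [Bool.eq_iff_iff, Bool.and_eq_true, foldl_or_eq_true]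
    by_cases hx : x = a
    · subst hx
      simp [hfa]
    · rw [flipAt_of_ne hx]
      obtain ⟨i, hi⟩ := Function.ne_iff.1 hx
      have : ∃ i ∈ List.finRange n, (x i ^^ a i) = true :=
        ⟨i, List.mem_finRange i, by simpa using hi⟩
      simp only [this, or_true, and_true]

/-- The functions computable with at most `g` gates. -/
def computableFunctions (B : GateBasis) (n : ℕ) (g : ℝ) : Set ((Fin n → Bool) → Bool) :=
  {f | ∃ s : ℕ, (s : ℝ) ≤ g ∧ Computes B n s {f}}

lemma computes_singleton_iff {s : ℕ} {f : (Fin n → Bool) → Bool} :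
    Computes B n s {f} ↔ ∃ C : BoolCircuit B n s, C.eval = f := by
  constructor
  · rintro ⟨L, hL⟩
    obtain ⟨w, hw⟩ := hL f rfl
    exact ⟨⟨L, w⟩, funext hw⟩
  · rintro ⟨⟨L, w⟩, rfl⟩
    refine ⟨L, ?_⟩
    rintro _ rfl
    exact ⟨w, fun x => rfl⟩

lemma psi_eq_ncard (B : GateBasis) (n : ℕ) (g : ℝ) :
    psi B n g = (computableFunctions B n g).ncard := by
  simp only [psi, computableFunctions, computes_singleton_iff]

lemma psi_mono (B : GateBasis) (n : ℕ) {g g' : ℝ} (h : g ≤ g') : psi B n g ≤ psi B n g' := by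
  simp only [psi_eq_ncard]
  refine Set.ncard_le_ncard ?_ (Set.toFinite _)
  rintro f ⟨s, hs, hf⟩
  exact ⟨s, hs.trans h, hf⟩

/-- Allowing `2 * n + 2` more gates multiplies the number of functions by at least `5 / 4`. -/
theorem five_fourths_mul_psi_le (hand : (fun a b : Bool => a && b) ∈ B.gates)
    (hor : (fun a b : Bool => a || b) ∈ B.gates)
    (hneg : B.negatedInputs ∨ ∃ op ∈ B.gates, ∀ a : Bool, op a a = !a)
    (hn : 0 < n) {g : ℝ} (hg : Real.logb 2 (psi B n g) ≤ 3 / 4 * 2 ^ n) :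
    5 / 4 * (psi B n g : ℝ) ≤ psi B n (g + (2 * n + 2)) := by
  classical
  set F := (computableFunctions B n g).toFinset with hFdef
  have hF : psi B n g = F.card := by
    rw [psi_eq_ncard, Set.ncard_eq_toFinset_card']
  rw [hF] at hg ⊢
  obtain ⟨a, ha⟩ := exists_card_le_card_union_image_flipAt F (by simpa using hg)
  refine ha.trans ?_
  rw [psi_eq_ncard, ← Set.ncard_coe_finset]
  refine Nat.cast_le.2 (Set.ncard_le_ncard ?_ (Set.toFinite _))
  intro f hf
  simp only [Finset.coe_union, Finset.coe_image, Set.mem_union, Set.mem_image, hFdef,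
    Set.coe_toFinset] at hf
  rcases hf with ⟨s, hs, hf⟩ | ⟨f, ⟨s, hs, hf⟩, rfl⟩
  · exact ⟨s, by linarith [Nat.cast_nonneg (α := ℝ) n], hf⟩
  · obtain ⟨s', hs', hf'⟩ := hf.flipAt hand hor hneg hn a
    refine ⟨s', ?_, hf'⟩
    have : (s' : ℝ) ≤ s + (2 * n + 2) := by exact_mod_cast hs'
    linarith

/-- By monotonicity, the bound on the count at `G` serves every intermediate step. -/
theorem pow_mul_psi_le (hand : (fun a b : Bool => a && b) ∈ B.gates)
    (hor : (fun a b : Bool => a || b) ∈ B.gates)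
    (hneg : B.negatedInputs ∨ ∃ op ∈ B.gates, ∀ a : Bool, op a a = !a)
    (hn : 0 < n) {g G : ℝ} (hpsi : (psi B n G : ℝ) ≤ 2 ^ (3 / 4 * 2 ^ n : ℝ)) (t : ℕ)
    (hG : g + t * (2 * n + 2) ≤ G) :
    (5 / 4) ^ t * (psi B n g : ℝ) ≤ psi B n (g + t * (2 * n + 2)) := by
  induction t with
  | zero => simp
  | succ t ih =>
    push_cast at hG ⊢
    have hG' : g + t * (2 * n + 2) ≤ G := by
      linarith [Nat.cast_nonneg (α := ℝ) n]
    have hlog : Real.logb 2 (psi B n (g + t * (2 * n + 2))) ≤ 3 / 4 * 2 ^ n := by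
      -- `g` may be negative, so the count may vanish; then `Real.logb 2 0 = 0`.
      rcases Nat.eq_zero_or_pos (psi B n (g + t * (2 * n + 2))) with h0 | h0
      · rw [h0]
        simp
      · rw [Real.logb_le_iff_le_rpow (by norm_num) (by exact_mod_cast h0)]
        exact le_trans (by exact_mod_cast psi_mono B n hG') hpsi
    calc (5 / 4 : ℝ) ^ (t + 1) * (psi B n g : ℝ)
        = 5 / 4 * ((5 / 4) ^ t * (psi B n g : ℝ)) := by ring
      _ ≤ 5 / 4 * (psi B n (g + t * (2 * n + 2)) : ℝ) := by gcongr; exact ih hG'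
      _ ≤ psi B n (g + t * (2 * n + 2) + (2 * n + 2)) :=
          five_fourths_mul_psi_le hand hor hneg hn hlog
      _ = psi B n (g + (t + 1) * (2 * n + 2)) := by ring_nf

end Circuits

/-! ### Upper bound on the number of circuits. -/

section Counting

variable (B : GateBasis) (n : ℕ)

lemma finite_and_card_wire_le (m : ℕ) :
    Finite (Wire B n m) ∧ Nat.card (Wire B n m) ≤ 2 * n + m := by
  let e : Wire B n m → Fin n ⊕ Fin n ⊕ Fin m := fun w => match w with
    | .input i => .inl i
    | .negInput _ i => .inr (.inl i)
    | .gate j => .inr (.inr j)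
  have he : Function.Injective e := by
    intro w w' h
    cases w <;> cases w' <;> simp_all [e]
  refine ⟨Finite.of_injective e he, (Nat.card_le_card_of_injective e he).trans ?_⟩
  simp
  omega

lemma finite_and_card_gate_le (m : ℕ) :
    Finite (Gate B n m) ∧ Nat.card (Gate B n m) ≤ 16 * (2 * n + m) ^ 2 := by
  obtain ⟨hfin, hcard⟩ := finite_and_card_wire_le B n m
  let e : Gate B n m → (Bool → Bool → Bool) × Wire B n m × Wire B n m :=
    fun G => (G.op, G.left, G.right)
  have he : Function.Injective e := by
    rintro ⟨_, _, _, _⟩ ⟨_, _, _, _⟩ h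
    simp_all [e]
  refine ⟨Finite.of_injective e he, (Nat.card_le_card_of_injective e he).trans ?_⟩
  rw [Nat.card_prod, Nat.card_prod, pow_two]
  have : Nat.card (Bool → Bool → Bool) = 16 := by simp
  rw [this]
  gcongr

lemma finite_and_card_gateList_le {s m : ℕ} (hs : s ≤ m) :
    Finite (GateList B n s) ∧ Nat.card (GateList B n s) ≤ (16 * (2 * n + m) ^ 2) ^ s := by
  induction s with
  | zero =>
    have : Subsingleton (GateList B n 0) := ⟨fun L L' => by cases L; cases L'; rfl⟩
    exact ⟨inferInstance, by simpa using Finite.card_le_one_iff_subsingleton.2 this⟩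
  | succ s ih =>
    obtain ⟨hfin, hcard⟩ := ih (by omega)
    obtain ⟨hfin', hcard'⟩ := finite_and_card_gate_le B n s
    let e : GateList B n (s + 1) → GateList B n s × Gate B n s := fun L => match L with
      | .snoc L G => (L, G)
    have he : Function.Injective e := by
      intro L L' h
      cases L
      cases L'
      simp_all [e]
    refine ⟨Finite.of_injective e he, (Nat.card_le_card_of_injective e he).trans ?_⟩
    rw [Nat.card_prod, pow_succ]
    refine Nat.mul_le_mul hcard (hcard'.trans ?_)
    gcongr
    omega

lemma finite_and_card_boolCircuit_le {s m : ℕ} (hs : s ≤ m) :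
    Finite (BoolCircuit B n s) ∧
      Nat.card (BoolCircuit B n s) ≤ (16 * (2 * n + m) ^ 2) ^ s * (2 * n + m) := by
  obtain ⟨hfin, hcard⟩ := finite_and_card_gateList_le B n hs
  obtain ⟨hfin', hcard'⟩ := finite_and_card_wire_le B n s
  let e : BoolCircuit B n s → GateList B n s × Wire B n s := fun C => (C.gates, C.output)
  have he : Function.Injective e := by
    rintro ⟨_, _⟩ ⟨_, _⟩ h
    simp_all [e]
  refine ⟨Finite.of_injective e he, (Nat.card_le_card_of_injective e he).trans ?_⟩
  rw [Nat.card_prod]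
  exact Nat.mul_le_mul hcard (hcard'.trans (by omega))

lemma psi_natCast_le (hn : 0 < n) (m : ℕ) :
    psi B n m ≤ (m + 1) * ((16 * (2 * n + m) ^ 2) ^ m * (2 * n + m)) := by
  have hsub : {f : (Fin n → Bool) → Bool |
      ∃ s : ℕ, (s : ℝ) ≤ m ∧ ∃ C : BoolCircuit B n s, C.eval = f} ⊆
      ⋃ s ∈ Finset.range (m + 1), Set.range (BoolCircuit.eval (B := B) (n := n) (s := s)) := by
    rintro f ⟨s, hs, C, rfl⟩
    simp only [Finset.mem_range, Set.mem_iUnion]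
    exact ⟨s, Nat.lt_succ_of_le (by exact_mod_cast hs), C, rfl⟩
  refine (Set.ncard_le_ncard hsub (Set.toFinite _)).trans ?_
  refine (Finset.set_ncard_biUnion_le _ _).trans ?_
  refine (Finset.sum_le_card_nsmul _ _
    ((16 * (2 * n + m) ^ 2) ^ m * (2 * n + m)) fun s hs => ?_).trans (by simp)
  have hs' : s ≤ m := Nat.le_of_lt_succ (Finset.mem_range.1 hs)
  obtain ⟨hfin, hcard⟩ := finite_and_card_boolCircuit_le B n hs'
  rw [← Nat.card_coe_set_eq]
  refine (Finite.card_range_le _).trans (hcard.trans ?_)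
  gcongr
  have : 0 < (2 * n + m) ^ 2 := by positivity
  omega

/-- The count is at most `2 ^ (2 * n * m + 2 * n)`. Here `2 * n * m` is at most half of `2 ^ n` and
`2 * n` at most an eighth, which leaves room below 3/4. -/
lemma psi_le_two_rpow {m : ℕ} (hn : 8 ≤ n) (hm : (m : ℝ) ≤ (2 : ℝ) ^ ((n : ℤ) - 2) / n) :
    (psi B n m : ℝ) ≤ 2 ^ (3 / 4 * 2 ^ n : ℝ) := by
  have hbig : 16 * n ≤ 2 ^ n := by
    induction n, hn using Nat.le_induction with
    | base => norm_num
    | succ k hk ih =>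
      have : 16 * k ≤ 2 ^ k := by
        clear ih hm
        induction k, hk using Nat.le_induction with
        | base => norm_num
        | succ k hk ih => rw [pow_succ]; omega
      rw [pow_succ]; omega
  have hnpos : (0 : ℝ) < n := by exact_mod_cast (by omega : 0 < n)
  have hmul : 4 * (m * n) ≤ 2 ^ n := by
    rw [le_div_iff₀ hnpos, zpow_sub₀ (by norm_num), zpow_natCast] at hm
    have : (4 * (m * n) : ℝ) ≤ 2 ^ n := by norm_num at hm; linarith
    exact_mod_cast this
  have hM : 4 * (2 * n + m) ≤ 2 ^ n := by
    have : 8 * m ≤ m * n := by rw [mul_comm]; gcongr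
    omega
  have hnat : psi B n m ≤ 2 ^ (n + (n * 2 * m + n)) := by
    refine (psi_natCast_le B n (by omega) m).trans ?_
    rw [pow_add, pow_add, pow_mul, pow_mul]
    have : 16 * (2 * n + m) ^ 2 ≤ (2 ^ n) ^ 2 := by
      calc 16 * (2 * n + m) ^ 2 = (4 * (2 * n + m)) ^ 2 := by ring
        _ ≤ _ := by gcongr
    refine Nat.mul_le_mul (by omega) (Nat.mul_le_mul ?_ (by omega))
    gcongr
  have hexp : ((n + (n * 2 * m + n) : ℕ) : ℝ) ≤ 3 / 4 * 2 ^ n := by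
    have h1 : (4 * (m * n) : ℝ) ≤ 2 ^ n := by exact_mod_cast hmul
    have h2 : (16 * n : ℝ) ≤ 2 ^ n := by exact_mod_cast hbig
    push_cast
    nlinarith
  calc (psi B n m : ℝ) ≤ ((2 ^ (n + (n * 2 * m + n)) : ℕ) : ℝ) := by exact_mod_cast hnat
    _ = (2 : ℝ) ^ ((n + (n * 2 * m + n) : ℕ) : ℝ) := by rw [Real.rpow_natCast]; push_cast; rfl
    _ ≤ _ := Real.rpow_le_rpow_of_exponent_le (by norm_num) hexp

end Counting

/-! ### Choice of the number of steps. -/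

theorem proposition2p9 (B : GateBasis)
    (hand : (fun a b : Bool => a && b) ∈ B.gates)
    (hor : (fun a b : Bool => a || b) ∈ B.gates)
    (hneg : B.negatedInputs ∨ ∃ op ∈ B.gates, ∀ a : Bool, op a a = !a)
    (γ : ℕ → ℕ)
    (hle : ∀ᶠ n : ℕ in atTop, (γ n : ℝ) ≤ (2 : ℝ) ^ ((n : ℤ) - 2) / (n : ℝ))
    (hout : Outstrips (fun n => (γ n : ℝ)) (fun n => (n : ℝ) * Real.logb 2 (n : ℝ)))
    (d : ℝ) :
    ∀ᶠ n : ℕ in atTop,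
      (n : ℝ) ^ d * (psi B n ((γ n : ℝ) / 2) : ℝ) ≤ (psi B n (γ n : ℝ) : ℝ) := by
  have hlog : 0 < Real.logb 2 (5 / 4) := Real.logb_pos (by norm_num) (by norm_num)
  -- Chosen so that `(5/4) ^ (K * log₂ n) = n ^ |d|`.
  set K : ℝ := |d| / Real.logb 2 (5 / 4) with hK
  have hK0 : 0 ≤ K := by positivity
  -- Rounding up gives `t ≤ (K + 1) * log₂ n`, and `2 * n + 2 ≤ 4 * n`; the factor 8 makes the total
  -- cost at most `γ n / 2`.
  obtain ⟨n₀, hn₀⟩ := hout (8 * (K + 1)) (by positivity)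
  filter_upwards [hle, eventually_ge_atTop n₀, eventually_ge_atTop 8] with n hγ hn hn8
  have hn8' : (8 : ℝ) ≤ n := by exact_mod_cast hn8
  have hlogn : 1 ≤ Real.logb 2 n := by
    rw [Real.le_logb_iff_rpow_le (by norm_num) (by linarith), Real.rpow_one]
    linarith
  set t := ⌈K * Real.logb 2 n⌉₊ with ht
  have ht1 : K * Real.logb 2 n ≤ t := Nat.le_ceil _
  have ht2 : (t : ℝ) ≤ (K + 1) * Real.logb 2 n := by
    have := Nat.ceil_lt_add_one (a := K * Real.logb 2 n) (by positivity)
    linarith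
  have hG : (γ n : ℝ) / 2 + t * (2 * n + 2) ≤ γ n := by
    have h1 : 8 * (K + 1) * (n * Real.logb 2 n) < γ n := hn₀ n hn
    have h2 : (t : ℝ) * (2 * n + 2) ≤ ((K + 1) * Real.logb 2 n) * (4 * n) := by
      gcongr
      linarith
    nlinarith
  have hpow : (n : ℝ) ^ d ≤ (5 / 4) ^ t := by
    rw [← Real.rpow_natCast, ← Real.logb_le_logb (b := 2) (by norm_num) (by positivity)
      (by positivity), Real.logb_rpow_eq_mul_logb_of_pos (by linarith),
      Real.logb_rpow_eq_mul_logb_of_pos (by norm_num)]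
    calc d * Real.logb 2 n ≤ |d| * Real.logb 2 n := by gcongr; exact le_abs_self d
      _ = (K * Real.logb 2 n) * Real.logb 2 (5 / 4) := by rw [hK]; field_simp
      _ ≤ _ := by gcongr
  calc (n : ℝ) ^ d * (psi B n ((γ n : ℝ) / 2) : ℝ)
      ≤ (5 / 4) ^ t * (psi B n ((γ n : ℝ) / 2) : ℝ) := by gcongr
    _ ≤ psi B n ((γ n : ℝ) / 2 + t * (2 * n + 2)) :=
        pow_mul_psi_le hand hor hneg (by omega) (psi_le_two_rpow B n hn8 hγ) t hG
    _ ≤ psi B n (γ n : ℝ) := by exact_mod_cast psi_mono B n hG
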